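/- Let $\mathcal U$ be a countable universe, $\mathcal P,\mathcal Q$ probability distributions on $\mathcal U$ with point probabilities $p_x,q_x$, let $n\ge 1$ and $0<F<1$, and write $\log=\log_2$. Let $\mathcal P_n$ be the law of $n$ independent draws (with replacement) from $\mathcal P$, and let $S$ be the set of drawn elements. For $0<G<1$ put $$k_x(G)=\begin{cases}0 & \text{if } q_x\le Gp_x \text{ or } p_x>1/n,\\ \log\!\big(\tfrac1G\cdot\tfrac{q_x}{p_x}\big) & \text{if } Gp_x<q_x\le\min\{p_x,G/n\},\\ \log(1/G) & \text{if } q_x>p_x \text{ and } p_x\le G/n,\\ \log(1/(np_x)) & \text{if } q_x>G/n \text{ and } G/n<p_x\le 1/n,\end{cases}$$ let $\mathcal U_2(G),\mathcal U_3(G),\mathcal U_4(G)$ be the sets of $x$ satisfying the conditions of the second, third and fourth case, and let $$\mathsf{LB}(\mathcal P_n,\mathcal Q,G)=n\Big(\sum_{x\in\mathcal U_2(G)}p_x\log\!\big(\tfrac1G\cdot\tfrac{q_x}{p_x}\big)+\sum_{x\in\mathcal U_3(G)}p_x\log\tfrac1G+\sum_{x\in\mathcal U_4(G)}p_x\log\tfrac1{np_x}\Big),\qquad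 \mathsf{DB}=\log(e)\cdot\mathsf{LB}(\mathcal P_n,\mathcal Q,F/6).$$ The Daisy Bloom filter stores an array of $\max\{1,\lceil\mathsf{DB}\rceil\}$ bits, initially $0$, and uses fully random hash functions $h_1,h_2,\dots$ into the positions of the array. Inserting $x$ sets the positions $h_1(x),\dots,h_{\kappa_x}(x)$ to $1$, and a query for $x$ answers YES iff these positions all hold $1$; here $\kappa_x=\lfloor k_x(G)\rfloor$, where either $G=F$ or $G=F/6$. A filter $A$ is a $\mathcal Q$-filter on $S$ with false positive rate at most $\varepsilon$ if $\Pr_A[A(S,x)=\mathrm{YES}]=1$ for all $x\in S$, and $\sum_{x\in\mathcal U\setminus S}q_x\Pr_A[A(S,x)=\mathrm{YES}]\le\varepsilon$. There are absolute constants $c,C>0$ such that, for all $\mathcal U,\mathcal P,\mathcal Q,n,F$ as above, with $L=\mathsf{LB}(\mathcal P_n,\mathcal Q,F/6)$ and $b=\log(6/F)$: 1. (Space.) $\big|\log(e)\,\mathsf{LB}(\mathcal P_n,\mathcal Q,F/6)-\log(e)\,\mathsf{LB}(\mathcal P_n,\mathcal Q,F)\big|\le Cn$, and the number of bits used lies between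 $\mathsf{DB}$ and $\mathsf{DB}+1$. 2. (Correctness.) If $n\sum_x p_xq_x\le F$, then for each of the two choices of $G$ there is a family $\mathcal T$ of subsets of $\mathcal U$ with $\Pr_{\mathcal P_n}[S\in\mathcal T]\ge 1-\exp(-cL/b^3)$ such that for every $S\in\mathcal T$: - the Daisy Bloom filter is a $\mathcal Q$-filter on $S$ with false positive rate at most $C\big(F+\exp(-cL/b^4)\big)$; - if $L\ge C b^4$, it is a $\mathcal Q$-filter on $S$ with false positive rate at most $C F$; - if $L\ge C b^4$, $G=F/6$ and $n\sum_x p_xq_x\le F/6$, it is a $\mathcal Q$-filter on $S$ with false positive rate at most $F$. -/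

import Mathlib

open MeasureTheory

noncomputable section

namespace Daisy

section Parameters

variable {U : Type*}

/-- The probability `p_x` of drawing `x`, as a real number. -/
def prob (P : PMF U) (x : U) : ℝ := (P x).toReal

/-- The real-valued parameter `k_x` of the Daisy Bloom filter (the four cases are exhaustive and
mutually exclusive when `0 < F < 1` and `1 ≤ n`). -/
def kReal (P Q : PMF U) (n : ℕ) (F : ℝ) (x : U) : ℝ :=
  open Classical in
  if prob Q x ≤ F * prob P x ∨ 1 / (n : ℝ) < prob P x then 0
  else if F * prob P x < prob Q x ∧ prob Q x ≤ min (prob P x) (F / n) then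
    Real.logb 2 (1 / F * (prob Q x / prob P x))
  else if prob P x < prob Q x ∧ prob P x ≤ F / n then Real.logb 2 (1 / F)
  else Real.logb 2 (1 / (n * prob P x))

/-- The number of hash functions used by `x`: the integer part of `k_x`. -/
def hashCount (P Q : PMF U) (n : ℕ) (F : ℝ) (x : U) : ℕ := ⌊kReal P Q n F x⌋₊

/-- The part `U₂` of the universe. -/
def U2 (P Q : PMF U) (n : ℕ) (F : ℝ) : Set U :=
  {x | F * prob P x < prob Q x ∧ prob Q x ≤ min (prob P x) (F / n)}

/-- The part `U₃` of the universe. -/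
def U3 (P Q : PMF U) (n : ℕ) (F : ℝ) : Set U :=
  {x | prob P x < prob Q x ∧ prob P x ≤ F / n}

/-- The part `U₄` of the universe. -/
def U4 (P Q : PMF U) (n : ℕ) (F : ℝ) : Set U :=
  {x | F / n < prob Q x ∧ F / n < prob P x ∧ prob P x ≤ 1 / n}

/-- The quantity `LB(P_n, Q, F)`. -/
def LB (P Q : PMF U) (n : ℕ) (F : ℝ) : ℝ :=
  n * ((∑' x : U2 P Q n F, prob P x * Real.logb 2 (1 / F * (prob Q x / prob P x)))
    + (∑' x : U3 P Q n F, prob P x * Real.logb 2 (1 / F))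
    + ∑' x : U4 P Q n F, prob P x * Real.logb 2 (1 / (n * prob P x)))

/-- The nominal length `DB(P_n, Q, F) = log₂ e · LB(P_n, Q, F/6)` of the bit array. -/
def DB (P Q : PMF U) (n : ℕ) (F : ℝ) : ℝ :=
  Real.logb 2 (Real.exp 1) * LB P Q n (F / 6)

/-- The length of the bit array: `DB` rounded up, and at least one, so that there is a position
to hash to. -/
def bits (P Q : PMF U) (n : ℕ) (F : ℝ) : ℕ := max 1 ⌈DB P Q n F⌉₊

instance (P Q : PMF U) (n : ℕ) (F : ℝ) : NeZero (bits P Q n F) :=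
  ⟨Nat.pos_iff_ne_zero.mp (lt_of_lt_of_le Nat.one_pos (le_max_left _ _))⟩

end Parameters

section Filters

variable {U : Type*}

/-- The law of `n` independent draws (with replacement) from `P`. The input set of a sequence `s`
of draws is `Set.range s`. -/
def inputLaw [MeasurableSpace U] (P : PMF U) (n : ℕ) : Measure (Fin n → U) :=
  Measure.pi fun _ => P.toMeasure

/-- A randomized filter with internal randomness `ω` of law `μ`, answering `answer ω S x` to the
query `x` after having been given the input set `S`, is a `Q`-filter on `S` with false positive
rate (at most) `ε`. -/
structure IsQFilter {Ω : Type*} [MeasurableSpace Ω] (Q : PMF U) (μ : Measure Ω)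
    (answer : Ω → Set U → U → Bool) (S : Set U) (ε : ℝ) : Prop where
  no_false_negatives : ∀ x ∈ S, μ {ω | answer ω S x = true} = 1
  false_positive_rate :
    ∑' x : (Sᶜ : Set U), prob Q x * μ.real {ω | answer ω S x = true} ≤ ε

/-- The hash values: `h (x, i)` is the position `h_{i+1}(x)` in an array of length `m`. -/
abbrev Hashes (U : Type*) (m : ℕ) : Type _ := U × ℕ → Fin m

/-- Fully random hashing: all hash values are independent and uniform. -/
def hashLaw (U : Type*) (m : ℕ) [NeZero m] : Measure (Hashes U m) :=
  Measure.infinitePi fun _ : U × ℕ => (PMF.uniformOfFintype (Fin m)).toMeasure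

/-- The bit array after the insertion of `S`: the positions `h_1(x), …, h_{k x}(x)`, `x ∈ S`, are
set to `1`. -/
def bitArray {m : ℕ} (k : U → ℕ) (h : Hashes U m) (S : Set U) : Fin m → Bool :=
  open Classical in fun j => decide (∃ x ∈ S, ∃ i < k x, h (x, i) = j)

/-- A query reads the `k x` positions of `x` and answers YES iff all of them hold a `1`. -/
def query {m : ℕ} (k : U → ℕ) (h : Hashes U m) (a : Fin m → Bool) (x : U) : Bool :=
  decide (∀ i < k x, a (h (x, i)) = true)

/-- The weighted Bloom filter with `k x` hash functions for `x`. -/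
def bloomAnswer {m : ℕ} (k : U → ℕ) (h : Hashes U m) (S : Set U) (x : U) : Bool :=
  query k h (bitArray k h S) x

/-- The Daisy Bloom filter with an array of `bits P Q n F` bits, and with the numbers of hash
functions computed from the parameter `G`, is a `Q`-filter on `S` with false positive rate at
most `ε`. -/
def DaisyIsQFilter (P Q : PMF U) (n : ℕ) (F G : ℝ) (S : Set U) (ε : ℝ) : Prop :=
  IsQFilter Q (hashLaw U (bits P Q n F)) (bloomAnswer (hashCount P Q n G)) S ε

end Filters

end Daisy

end

noncomputable section

namespace Daisy

-- The parameters k_x and the functional LB.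

section Parameters

variable {U : Type*}

-- Where p_x and q_x are positive, k_x is the minimum of log(1/G), log(q_x/(G p_x)) and log(1/(n
-- p_x)), clamped below at 0 (`kReal_eq_logb`). Two facts follow. The weight q_x 2^{-k_x} is bounded
-- by G p_x, G q_x or n p_x q_x, according to the arm that is active (`prob_mul_rpow_neg_kReal`), so
-- its total is O(F). And LB is n times the mean of k_x under P (`LB_eq_tsum`), that is, the
-- expected number of hash values before rounding.
--
-- An array of L / ln 2 bits receiving about L hash values is about half full, so x should be a
-- false positive with probability about 2^{-k_x}. Negative dependence of the occupied positions
-- makes this rigorous, with a correction k_x/m for collisions among the query's own hash values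
-- (`hashLaw_real_query_le`). A Chernoff bound keeps the load within L/(100 b) of its mean; the
-- occupation is then at most (1 + 1/(25 b))/2, and since k_x ≤ b, raising this to the power ⌊k_x⌋
-- costs only a constant factor.
--
-- Rounding k_x down costs 2^δ ≤ 1 + δ, where δ in [0, 1) is the rounding error. This gives rate
-- O(F) at once. For the exact rate F, a large mean rounding error is offset by the lighter load it
-- causes (`daisyIsQFilter_sharp`).

theorem prob_nonneg (P : PMF U) (x : U) : 0 ≤ prob P x := ENNReal.toReal_nonneg

theorem summable_prob (P : PMF U) : Summable (prob P) :=
  ENNReal.summable_toReal P.tsum_coe_ne_top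

theorem tsum_prob (P : PMF U) : ∑' x, prob P x = 1 := by
  unfold prob
  rw [← ENNReal.tsum_toReal_eq (fun x => P.apply_ne_top x), P.tsum_coe]
  simp

theorem prob_le_one (P : PMF U) (x : U) : prob P x ≤ 1 :=
  ENNReal.toReal_le_of_le_ofReal zero_le_one (by simpa using P.coe_le_one x)

theorem summable_prob_mul (P : PMF U) {f : U → ℝ} {B : ℝ} (h0 : ∀ x, 0 ≤ f x)
    (hB : ∀ x, f x ≤ B) : Summable fun x => prob P x * f x :=
  Summable.of_nonneg_of_le (fun x => mul_nonneg (prob_nonneg P x) (h0 x))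
    (fun x => mul_le_mul_of_nonneg_left (hB x) (prob_nonneg P x))
    ((summable_prob P).mul_right B)

/-- The cases defining `k_x`, in logarithmic coordinates. -/
theorem kReal_eq_logb {P Q : PMF U} {n : ℕ} {G : ℝ} {x : U} (hn : 1 ≤ n) (hG : 0 < G)
    (hG1 : G < 1) (hp : 0 < prob P x) (hq : 0 < prob Q x) :
    kReal P Q n G x = max 0 (min (Real.logb 2 (1 / G))
      (min (Real.logb 2 (1 / G) + Real.logb 2 (prob Q x) - Real.logb 2 (prob P x))
        (- Real.logb 2 n - Real.logb 2 (prob P x)))) := by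
  have hn' : (0 : ℝ) < n := by exact_mod_cast hn
  have l2 : (1 : ℝ) < 2 := one_lt_two
  have e1 : prob Q x ≤ G * prob P x ↔
      Real.logb 2 (prob Q x) ≤ Real.logb 2 G + Real.logb 2 (prob P x) := by
    rw [← Real.logb_mul hG.ne' hp.ne', Real.logb_le_logb l2 hq (by positivity)]
  have e2 : 1 / (n : ℝ) < prob P x ↔ - Real.logb 2 n < Real.logb 2 (prob P x) := by
    rw [← Real.logb_inv, Real.logb_lt_logb_iff l2 (by positivity) hp, one_div]
  have e3 : prob Q x ≤ prob P x ↔ Real.logb 2 (prob Q x) ≤ Real.logb 2 (prob P x) := by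
    rw [Real.logb_le_logb l2 hq hp]
  have e4 : prob Q x ≤ G / n ↔ Real.logb 2 (prob Q x) ≤ Real.logb 2 G - Real.logb 2 n := by
    rw [← Real.logb_div hG.ne' hn'.ne', Real.logb_le_logb l2 hq (by positivity)]
  have e5 : prob P x ≤ G / n ↔ Real.logb 2 (prob P x) ≤ Real.logb 2 G - Real.logb 2 n := by
    rw [← Real.logb_div hG.ne' hn'.ne', Real.logb_le_logb l2 hp (by positivity)]
  have v0 : Real.logb 2 (1 / G) = - Real.logb 2 G := by rw [one_div, Real.logb_inv]
  have v1 : Real.logb 2 (1 / G * (prob Q x / prob P x)) =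
      - Real.logb 2 G + Real.logb 2 (prob Q x) - Real.logb 2 (prob P x) := by
    rw [Real.logb_mul (by positivity) (by positivity), Real.logb_div hq.ne' hp.ne', v0]
    ring
  have v2 : Real.logb 2 (1 / (n * prob P x)) = - Real.logb 2 n - Real.logb 2 (prob P x) := by
    rw [one_div, Real.logb_inv, Real.logb_mul hn'.ne' hp.ne']
    ring
  unfold kReal
  have e6 := not_congr e1
  have e7 := not_congr e3
  rw [not_le, not_le] at e6 e7
  simp only [le_min_iff, v0, v1, v2, e1, e2, e3, e4, e5, e6, e7]
  have u0 : Real.logb 2 G < 0 := Real.logb_neg l2 hG hG1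
  -- What remains is a piecewise linear identity in four reals, about which only log G < 0 is
  -- needed.
  generalize Real.logb 2 (prob P x) = lp
  generalize Real.logb 2 (prob Q x) = lq
  generalize Real.logb 2 (n : ℝ) = ln
  generalize Real.logb 2 G = u at *
  simp only [max_def, min_def]
  clear * - u0
  split_ifs <;> grind

/-- Zero probabilities are treated apart because `Real.logb 2 0 = 0` makes the logarithmic formula
meaningless there. -/
theorem kReal_of_prob_eq_zero_left {P Q : PMF U} {n : ℕ} {G : ℝ} {x : U} (hG : 0 < G)
    (hp : prob P x = 0) (hq : 0 < prob Q x) : kReal P Q n G x = Real.logb 2 (1 / G) := by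
  have h2 : 0 ≤ G / n := by positivity
  simp [kReal, hp, hq.not_ge, hq, h2]

theorem kReal_of_prob_eq_zero_right {P Q : PMF U} {n : ℕ} {G : ℝ} {x : U} (hG : 0 < G)
    (hq : prob Q x = 0) : kReal P Q n G x = 0 := by
  have h2 : 0 ≤ G * prob P x := mul_nonneg hG.le (prob_nonneg P x)
  simp [kReal, hq, h2]

theorem kReal_nonneg {P Q : PMF U} {n : ℕ} {G : ℝ} (hn : 1 ≤ n) (hG : 0 < G) (hG1 : G < 1)
    (x : U) : 0 ≤ kReal P Q n G x := by
  rcases (prob_nonneg Q x).eq_or_lt with hq | hq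
  · rw [kReal_of_prob_eq_zero_right hG hq.symm]
  rcases (prob_nonneg P x).eq_or_lt with hp | hp
  · rw [kReal_of_prob_eq_zero_left hG hp.symm hq]
    exact Real.logb_nonneg one_lt_two (one_le_one_div hG hG1.le)
  rw [kReal_eq_logb hn hG hG1 hp hq]
  exact le_max_left _ _

theorem kReal_le {P Q : PMF U} {n : ℕ} {G : ℝ} (hn : 1 ≤ n) (hG : 0 < G) (hG1 : G < 1)
    (x : U) : kReal P Q n G x ≤ Real.logb 2 (1 / G) := by
  have h0 : 0 ≤ Real.logb 2 (1 / G) := Real.logb_nonneg one_lt_two (one_le_one_div hG hG1.le)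
  rcases (prob_nonneg Q x).eq_or_lt with hq | hq
  · rwa [kReal_of_prob_eq_zero_right hG hq.symm]
  rcases (prob_nonneg P x).eq_or_lt with hp | hp
  · rw [kReal_of_prob_eq_zero_left hG hp.symm hq]
  rw [kReal_eq_logb hn hG hG1 hp hq]
  exact max_le h0 (min_le_left _ _)

/-- Replacing H by G adds the same nonnegative constant to two arms of the minimum and leaves the
third alone, so the clamped minimum rises by at most that constant. -/
theorem kReal_sub_mem {P Q : PMF U} {n : ℕ} {G H : ℝ} (hn : 1 ≤ n) (hG : 0 < G) (hGH : G ≤ H)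
    (hH1 : H < 1) (x : U) :
    kReal P Q n H x ≤ kReal P Q n G x ∧
      kReal P Q n G x ≤ kReal P Q n H x + Real.logb 2 (H / G) := by
  have hH : 0 < H := hG.trans_le hGH
  have e : Real.logb 2 (1 / G) = Real.logb 2 (1 / H) + Real.logb 2 (H / G) := by
    rw [← Real.logb_mul (by positivity) (by positivity)]
    congr 1
    field_simp
  have h0 : 0 ≤ Real.logb 2 (H / G) := Real.logb_nonneg one_lt_two ((one_le_div hG).2 hGH)
  rcases (prob_nonneg Q x).eq_or_lt with hq | hq
  · rw [kReal_of_prob_eq_zero_right hG hq.symm, kReal_of_prob_eq_zero_right hH hq.symm]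
    simpa using h0
  rcases (prob_nonneg P x).eq_or_lt with hp | hp
  · rw [kReal_of_prob_eq_zero_left hG hp.symm hq, kReal_of_prob_eq_zero_left hH hp.symm hq, e]
    simpa using h0
  rw [kReal_eq_logb hn hG (hGH.trans_lt hH1) hp hq, kReal_eq_logb hn hH hH1 hp hq, e]
  grind

/-- The weight `q_x 2^{-k_x}` with which `x` contributes to the false positive rate. -/
theorem prob_mul_rpow_neg_kReal {P Q : PMF U} {n : ℕ} {G : ℝ} (hn : 1 ≤ n) (hG : 0 < G)
    (hG1 : G < 1) (x : U) :
    prob Q x * 2 ^ (-kReal P Q n G x) ≤ G * prob P x ∨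
      (kReal P Q n G x = Real.logb 2 (1 / G) ∧
        prob Q x * 2 ^ (-kReal P Q n G x) = G * prob Q x) ∨
      prob Q x * 2 ^ (-kReal P Q n G x) ≤ n * (prob P x * prob Q x) := by
  have hn' : (0 : ℝ) < n := by exact_mod_cast hn
  have e3 : (2 : ℝ) ^ (-Real.logb 2 (1 / G)) = G := by
    rw [one_div, Real.logb_inv, neg_neg, Real.rpow_logb two_pos (by norm_num) hG]
  rcases (prob_nonneg Q x).eq_or_lt with hq | hq
  · left
    rw [← hq, zero_mul]
    exact mul_nonneg hG.le (prob_nonneg P x)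
  rcases (prob_nonneg P x).eq_or_lt with hp | hp
  · refine Or.inr (Or.inl ?_)
    rw [kReal_of_prob_eq_zero_left hG hp.symm hq, e3]
    exact ⟨rfl, mul_comm _ _⟩
  have e1 : G * prob P x = prob Q x * 2 ^ (-(Real.logb 2 (1 / G) + Real.logb 2 (prob Q x)
      - Real.logb 2 (prob P x))) := by
    rw [← Real.logb_mul (by positivity) (by positivity), ← Real.logb_div (by positivity) hp.ne',
      ← Real.logb_inv, Real.rpow_logb two_pos (by norm_num) (by positivity)]
    field_simp
  have e2 : n * (prob P x * prob Q x) = prob Q x * 2 ^ (-(- Real.logb 2 n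
      - Real.logb 2 (prob P x))) := by
    rw [← neg_add', neg_neg, ← Real.logb_mul (by positivity) (by positivity),
      Real.rpow_logb two_pos (by norm_num) (by positivity)]
    ring
  have key : ∀ {a b : ℝ}, a ≤ b → prob Q x * 2 ^ (-b) ≤ prob Q x * 2 ^ (-a) := fun h =>
    mul_le_mul_of_nonneg_left (Real.rpow_le_rpow_of_exponent_le one_le_two (neg_le_neg h)) hq.le
  have h := kReal_eq_logb (n := n) hn hG hG1 hp hq
  have h0 : 0 ≤ Real.logb 2 (1 / G) := Real.logb_nonneg one_lt_two (one_le_one_div hG hG1.le)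
  rw [e1, e2]
  -- Each arm lying at or below k_x gives its own bound. If neither of the two arms tested does, k_x
  -- equals the remaining arm log(1/G).
  by_cases c1 : Real.logb 2 (1 / G) + Real.logb 2 (prob Q x) - Real.logb 2 (prob P x)
      ≤ kReal P Q n G x
  · exact Or.inl (key c1)
  by_cases c2 : - Real.logb 2 n - Real.logb 2 (prob P x) ≤ kReal P Q n G x
  · exact Or.inr (Or.inr (key c2))
  have h3 : kReal P Q n G x = Real.logb 2 (1 / G) := by grind
  refine Or.inr (Or.inl ⟨h3, ?_⟩)
  rw [h3, e3, mul_comm]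

/-- The three sets are disjoint, k_x has the matching value on each, and it vanishes outside their
union. -/
theorem LB_eq_tsum {P Q : PMF U} {n : ℕ} {G : ℝ} (hn : 1 ≤ n) (hG : 0 < G) (hG1 : G < 1) :
    LB P Q n G = n * ∑' x, prob P x * kReal P Q n G x := by
  have hn' : (0 : ℝ) < n := by exact_mod_cast hn
  have hd : G / n ≤ 1 / n := div_le_div_of_nonneg_right hG1.le hn'.le
  have hs : Summable fun x => prob P x * kReal P Q n G x :=
    summable_prob_mul P (kReal_nonneg hn hG hG1) (kReal_le hn hG hG1)
  have h2 : ∀ x ∈ U2 P Q n G,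
      kReal P Q n G x = Real.logb 2 (1 / G * (prob Q x / prob P x)) := by
    intro x hx
    have hx' := hx
    obtain ⟨a, b⟩ := hx'
    have hp : prob P x ≤ 1 / n := by
      have : G * prob P x ≤ G * (1 / n) := by
        rw [mul_one_div]
        exact a.le.trans (b.trans (min_le_right _ _))
      exact le_of_mul_le_mul_left this hG
    rw [kReal, if_neg (not_or.2 ⟨a.not_ge, hp.not_gt⟩), if_pos ⟨a, b⟩]
  have h3 : ∀ x ∈ U3 P Q n G, kReal P Q n G x = Real.logb 2 (1 / G) := by
    rintro x ⟨a, b⟩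
    have hp : G * prob P x ≤ prob P x := mul_le_of_le_one_left (prob_nonneg P x) hG1.le
    rw [kReal, if_neg (not_or.2 ⟨(hp.trans_lt a).not_ge, (b.trans hd).not_gt⟩),
      if_neg (fun h => (h.2.trans (min_le_left _ _)).not_gt a), if_pos ⟨a, b⟩]
  have h4 : ∀ x ∈ U4 P Q n G, kReal P Q n G x = Real.logb 2 (1 / (n * prob P x)) := by
    rintro x ⟨a, b, c⟩
    have hp : G * prob P x ≤ G / n := by
      rw [← mul_one_div]
      exact mul_le_mul_of_nonneg_left c hG.le
    rw [kReal, if_neg (not_or.2 ⟨(hp.trans_lt a).not_ge, c.not_gt⟩),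
      if_neg (fun h => (h.2.trans (min_le_right _ _)).not_gt a), if_neg (fun h => h.2.not_gt b)]
  have t2 : ∑' x : U2 P Q n G, prob P x * Real.logb 2 (1 / G * (prob Q x / prob P x)) =
      ∑' x : U2 P Q n G, prob P x * kReal P Q n G x :=
    tsum_congr fun x => by rw [h2 x x.2]
  have t3 : ∑' x : U3 P Q n G, prob P x * Real.logb 2 (1 / G) =
      ∑' x : U3 P Q n G, prob P x * kReal P Q n G x :=
    tsum_congr fun x => by rw [h3 x x.2]
  have t4 : ∑' x : U4 P Q n G, prob P x * Real.logb 2 (1 / (n * prob P x)) =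
      ∑' x : U4 P Q n G, prob P x * kReal P Q n G x :=
    tsum_congr fun x => by rw [h4 x x.2]
  have d23 : Disjoint (U2 P Q n G) (U3 P Q n G) :=
    Set.disjoint_left.2 fun x h h' => (h.2.trans (min_le_left _ _)).not_gt h'.1
  have d4 : Disjoint (U2 P Q n G ∪ U3 P Q n G) (U4 P Q n G) := by
    refine Set.disjoint_left.2 ?_
    rintro x (h | h) h'
    · exact (h.2.trans (min_le_right _ _)).not_gt h'.1
    · exact h.2.not_gt h'.2.1
  rw [LB, t2, t3, t4, ← (hs.subtype _).tsum_union_disjoint d23 (hs.subtype _),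
    ← (hs.subtype _).tsum_union_disjoint d4 (hs.subtype _)]
  congr 1
  refine tsum_subtype_eq_of_support_subset (f := fun x => prob P x * kReal P Q n G x) fun x hx => ?_
  by_contra hU
  refine hx (mul_eq_zero_of_right _ ?_)
  simp only [Set.mem_union, not_or] at hU
  obtain ⟨⟨n2, n3⟩, n4⟩ := hU
  by_cases c1 : prob Q x ≤ G * prob P x ∨ 1 / (n : ℝ) < prob P x
  · rw [kReal, if_pos c1]
  exfalso
  obtain ⟨c1, c2⟩ := not_or.1 c1
  simp only [U2, U3, U4, Set.mem_ofPred_eq, not_and, not_le, le_min_iff] at n2 n3 n4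
  rcases le_or_gt (prob Q x) (prob P x) with h | h
  · rcases le_or_gt (prob Q x) (G / n) with h' | h'
    · exact (n2 (not_le.1 c1) h).not_ge h'
    · exact c2 (n4 h' (h'.trans_le h))
  · exact c2 (n4 ((n3 h).trans h) (n3 h))

theorem LB_nonneg {P Q : PMF U} {n : ℕ} {G : ℝ} (hn : 1 ≤ n) (hG : 0 < G) (hG1 : G < 1) :
    0 ≤ LB P Q n G := by
  rw [LB_eq_tsum hn hG hG1]
  exact mul_nonneg n.cast_nonneg
    (tsum_nonneg fun x => mul_nonneg (prob_nonneg P x) (kReal_nonneg hn hG hG1 x))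

theorem LB_sub_mem {P Q : PMF U} {n : ℕ} {G H : ℝ} (hn : 1 ≤ n) (hG : 0 < G) (hGH : G ≤ H)
    (hH1 : H < 1) :
    LB P Q n H ≤ LB P Q n G ∧ LB P Q n G ≤ LB P Q n H + n * Real.logb 2 (H / G) := by
  have hG1 := hGH.trans_lt hH1
  have hH := hG.trans_le hGH
  have hsG : Summable fun x => prob P x * kReal P Q n G x :=
    summable_prob_mul P (kReal_nonneg hn hG hG1) (kReal_le hn hG hG1)
  have hsH : Summable fun x => prob P x * kReal P Q n H x :=
    summable_prob_mul P (kReal_nonneg hn hH hH1) (kReal_le hn hH hH1)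
  rw [LB_eq_tsum hn hG hG1, LB_eq_tsum hn hH hH1, ← mul_add]
  refine ⟨mul_le_mul_of_nonneg_left (hsH.tsum_le_tsum (fun x => ?_) hsG) n.cast_nonneg,
    mul_le_mul_of_nonneg_left ?_ n.cast_nonneg⟩
  · exact mul_le_mul_of_nonneg_left (kReal_sub_mem hn hG hGH hH1 x).1 (prob_nonneg P x)
  · calc ∑' x, prob P x * kReal P Q n G x
        ≤ ∑' x, (prob P x * kReal P Q n H x + prob P x * Real.logb 2 (H / G)) := by
          refine hsG.tsum_le_tsum (fun x => ?_) (hsH.add ((summable_prob P).mul_right _))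
          rw [← mul_add]
          exact mul_le_mul_of_nonneg_left (kReal_sub_mem hn hG hGH hH1 x).2 (prob_nonneg P x)
      _ = _ := by
          rw [hsH.tsum_add ((summable_prob P).mul_right _), tsum_mul_right, tsum_prob, one_mul]

end Parameters

-- Random hashing: occupation of the array and false positives.

section Hashing

open ProbabilityTheory

variable {U : Type*} {m : ℕ}

theorem measurable_eval_hashes (i : U × ℕ) : Measurable fun h : Hashes U m => h i :=
  measurable_pi_apply i

variable [NeZero m]

instance : IsProbabilityMeasure (hashLaw U m) := by
  unfold hashLaw
  infer_instance

/-- A hash value is uniform and independent of every event determined by finitely many other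
hash values. -/
theorem hashLaw_real_inter {N : Finset (U × ℕ)} {i : U × ℕ} (hi : i ∉ N) (v : Fin m)
    (E : Set (N → Fin m)) :
    (hashLaw U m).real {h | h i = v ∧ (fun j : N => h j) ∈ E} =
      (hashLaw U m).real {h | (fun j : N => h j) ∈ E} / m := by
  have hind : iIndepFun (fun (j : U × ℕ) (h : Hashes U m) => h j) (hashLaw U m) :=
    iIndepFun_infinitePi (X := fun _ => id) fun _ => measurable_id
  have h2 := hind.indepFun_finset {i} N (Finset.disjoint_singleton_left.2 hi)
    measurable_eval_hashes
  have h3 := h2.measure_inter_preimage_eq_mul {f | f ⟨i, Finset.mem_singleton_self i⟩ = v} E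
    (Set.toFinite _).measurableSet (Set.toFinite _).measurableSet
  have h4 : hashLaw U m {h | h i = v} = (m : ENNReal)⁻¹ := by
    have := (measurePreserving_eval_infinitePi
      (fun _ : U × ℕ => (PMF.uniformOfFintype (Fin m)).toMeasure) i).measure_preimage
      (measurableSet_singleton v).nullMeasurableSet
    rw [PMF.toMeasure_apply_singleton _ _ (measurableSet_singleton v)] at this
    rw [PMF.uniformOfFintype_apply, Fintype.card_fin] at this
    exact this
  have h5 : {h : Hashes U m | h i = v ∧ (fun j : N => h j) ∈ E} =
      (fun h (j : ({i} : Finset (U × ℕ))) => h j) ⁻¹'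
        {f | f ⟨i, Finset.mem_singleton_self i⟩ = v} ∩ (fun h (j : N) => h j) ⁻¹' E := rfl
  rw [Measure.real, h5, h3, ENNReal.toReal_mul]
  have h6 : (fun (h : Hashes U m) (j : ({i} : Finset (U × ℕ))) => h j) ⁻¹'
        {f | f ⟨i, Finset.mem_singleton_self i⟩ = v} = {h | h i = v} := rfl
  rw [h6, h4, ENNReal.toReal_inv, ENNReal.toReal_natCast, mul_comm, ← div_eq_mul_inv]
  rfl

/-- Conditioning on one hash value. -/
theorem hashLaw_real_eq_sum {N : Finset (U × ℕ)} {i : U × ℕ} (hi : i ∉ N)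
    (E : Fin m → Set (N → Fin m)) :
    (hashLaw U m).real {h | (fun j : N => h j) ∈ E (h i)} =
      ∑ v, (hashLaw U m).real {h | (fun j : N => h j) ∈ E v} / m := by
  have hE : {h : Hashes U m | (fun j : N => h j) ∈ E (h i)} =
      ⋃ v, {h | h i = v ∧ (fun j : N => h j) ∈ E v} := by
    ext h
    simp
  rw [hE, measureReal_iUnion_fintype]
  · exact Finset.sum_congr rfl fun v _ => hashLaw_real_inter hi v (E v)
  · intro v w hvw
    exact Set.disjoint_left.2 fun h h1 h2 => hvw (h1.1.symm.trans h2.1)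
  · intro v
    refine (measurable_eval_hashes i (measurableSet_singleton v)).inter ?_
    exact (measurable_pi_lambda (fun (h : Hashes U m) (j : N) => h j)
      fun j => measurable_eval_hashes _) (Set.toFinite (E v)).measurableSet

/-- The probability that a given position is hit by one of `t` hash values. -/
def hitProb (m t : ℕ) : ℝ := 1 - (1 - 1 / (m : ℝ)) ^ t

theorem one_div_le_one_of_neZero (m : ℕ) [NeZero m] : 1 / (m : ℝ) ≤ 1 := by
  rw [div_le_one (by exact_mod_cast NeZero.pos m)]
  exact_mod_cast NeZero.one_le

theorem hitProb_nonneg (m : ℕ) [NeZero m] (t : ℕ) : 0 ≤ hitProb m t := by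
  have h := one_div_le_one_of_neZero m
  have h' : 0 ≤ 1 / (m : ℝ) := by positivity
  exact sub_nonneg.2 (pow_le_one₀ (by linarith) (by linarith))

theorem hitProb_le_one (m : ℕ) [NeZero m] (t : ℕ) : hitProb m t ≤ 1 := by
  have h := one_div_le_one_of_neZero m
  exact sub_le_self _ (pow_nonneg (by linarith) _)

theorem hitProb_mono (m : ℕ) [NeZero m] {s t : ℕ} (hst : s ≤ t) : hitProb m s ≤ hitProb m t := by
  have h := one_div_le_one_of_neZero m
  have h' : 0 ≤ 1 / (m : ℝ) := by positivity
  exact sub_le_sub_left (pow_le_pow_of_le_one (by linarith) (by linarith) hst) _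

theorem hitProb_succ (m t : ℕ) : hitProb m (t + 1) = hitProb m t + (1 - hitProb m t) / m := by
  unfold hitProb
  ring

/-- These are the first two terms of the binomial expansion. At r = 0 the truncated exponent r - 1
is harmless because of the factor r. -/
theorem pow_add_mul_le_add_pow {p d : ℝ} (hp : 0 ≤ p) (hd : 0 ≤ d) (r : ℕ) :
    p ^ r + r * p ^ (r - 1) * d ≤ (p + d) ^ r := by
  induction r with
  | zero => simp
  | succ r ih =>
    have h := mul_le_mul_of_nonneg_right ih (add_nonneg hp hd)
    rw [← pow_succ] at h
    refine le_trans ?_ h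
    rcases r with _ | r
    · simp
    · have : 0 ≤ p ^ r * d ^ 2 * (r + 1) := by positivity
      simp only [Nat.add_sub_cancel]
      push_cast
      linear_combination this

/-- Negative dependence: the positions in `A` are all hit with probability at most the product
of the individual probabilities. -/
theorem hashLaw_real_cover_le (N : Finset (U × ℕ)) (A : Finset (Fin m)) :
    (hashLaw U m).real {h | ∀ a ∈ A, ∃ i ∈ N, h i = a} ≤ hitProb m N.card ^ A.card := by
  classical
  have hm : (0 : ℝ) < m := by exact_mod_cast NeZero.pos m
  induction N using Finset.induction_on generalizing A with
  | empty =>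
    rcases A.eq_empty_or_nonempty with rfl | ⟨a, ha⟩
    · simp
    · have : {h : Hashes U m | ∀ a ∈ A, ∃ i ∈ (∅ : Finset (U × ℕ)), h i = a} = ∅ := by
        ext h
        simpa using ⟨a, ha⟩
      rw [this]
      simpa using pow_nonneg (hitProb_nonneg m 0) _
  | insert i N hi ih =>
    -- Revealing the hash value at i strikes it from A; the other hash values must cover what is
    -- left.
    have h1 : {h : Hashes U m | ∀ a ∈ A, ∃ j ∈ insert i N, h j = a} =
        {h | (fun j : N => h j) ∈ {f : N → Fin m | ∀ a ∈ A.erase (h i), ∃ j, f j = a}} := by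
      ext h
      simp only [Set.mem_ofPred_eq, Finset.mem_insert, Finset.mem_erase, exists_eq_or_imp,
        Subtype.exists, exists_prop]
      grind
    have h2 : ∀ v, {h : Hashes U m | (fun j : N => h j) ∈
        {f : N → Fin m | ∀ a ∈ A.erase v, ∃ j, f j = a}} =
        {h | ∀ a ∈ A.erase v, ∃ j ∈ N, h j = a} := by
      intro v
      ext h
      simp
    rw [h1, hashLaw_real_eq_sum hi fun v => {f : N → Fin m | ∀ a ∈ A.erase v, ∃ j, f j = a}]
    simp only [h2]
    rw [Finset.card_insert_of_notMem hi, hitProb_succ]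
    set p := hitProb m N.card with hp
    have hp0 : 0 ≤ p := hitProb_nonneg _ _
    have hp1 : p ≤ 1 := hitProb_le_one _ _
    calc ∑ v, (hashLaw U m).real {h | ∀ a ∈ A.erase v, ∃ j ∈ N, h j = a} / m
        ≤ ∑ v, (if v ∈ A then p ^ (A.card - 1) else p ^ A.card) / m := by
          refine Finset.sum_le_sum fun v _ => div_le_div_of_nonneg_right ?_ hm.le
          refine (ih (A.erase v)).trans_eq ?_
          rw [Finset.card_erase_eq_ite]
          split_ifs <;> rfl
      _ = (A.card * p ^ (A.card - 1) + (m - A.card) * p ^ A.card) / m := by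
          rw [← Finset.sum_div, Finset.sum_ite, Finset.sum_const, Finset.sum_const,
            Finset.filter_mem_eq_inter, Finset.univ_inter, Finset.filter_not,
            Finset.filter_mem_eq_inter, Finset.univ_inter, Finset.card_sdiff_of_subset
              (Finset.subset_univ A), Finset.card_univ, Fintype.card_fin, nsmul_eq_mul,
            nsmul_eq_mul, Nat.cast_sub (by simpa using Finset.card_le_univ A)]
      -- With r = |A| the left side is p^r + r p^(r-1) (1-p)/m, the start of the binomial expansion.
      _ ≤ (p + (1 - p) / m) ^ A.card := by
          have hd : 0 ≤ (1 - p) / m := div_nonneg (by linarith) hm.le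
          refine le_trans (le_of_eq ?_) (pow_add_mul_le_add_pow hp0 hd A.card)
          rcases Nat.eq_zero_or_pos A.card with h0 | h0
          · rw [h0]
            simp [hm.ne']
          · obtain ⟨r, hr⟩ := Nat.exists_eq_add_of_lt h0
            rw [hr]
            simp only [zero_add, Nat.add_sub_cancel]
            field_simp
            push_cast
            ring

/-- The probability that the hash values indexed by `M` (and the positions in `A`) are all among
the hash values indexed by `N`. -/
theorem hashLaw_real_query_le {N M : Finset (U × ℕ)} (hMN : Disjoint M N) (A : Finset (Fin m)) :
    (hashLaw U m).real {h | (∀ a ∈ A, ∃ i ∈ N, h i = a) ∧ ∀ l ∈ M, ∃ i ∈ N, h i = h l} ≤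
      hitProb m N.card ^ A.card *
        (hitProb m N.card + ((A.card : ℝ) + M.card) / m) ^ M.card := by
  classical
  have hm : (0 : ℝ) < m := by exact_mod_cast NeZero.pos m
  induction M using Finset.induction_on generalizing A with
  | empty => simpa using hashLaw_real_cover_le N A
  | insert l M hl ih =>
    obtain ⟨hlN, hMN⟩ := Finset.disjoint_insert_left.1 hMN
    have hlK : l ∉ M ∪ N := by simp [hl, hlN]
    -- Revealing one query hash adds its value to the positions to be covered, which is why the
    -- induction carries a general A.
    have h1 : {h : Hashes U m | (∀ a ∈ A, ∃ i ∈ N, h i = a) ∧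
          ∀ k ∈ insert l M, ∃ i ∈ N, h i = h k} =
        {h | (fun j : (M ∪ N : Finset _) => h j) ∈ {f : (M ∪ N : Finset _) → Fin m |
          (∀ a ∈ insert (h l) A, ∃ i : (M ∪ N : Finset _), i.1 ∈ N ∧ f i = a) ∧
          ∀ k : (M ∪ N : Finset _), k.1 ∈ M → ∃ i : (M ∪ N : Finset _), i.1 ∈ N ∧ f i = f k}} := by
      ext h
      simp only [Set.mem_ofPred_eq, Finset.mem_insert, forall_eq_or_imp, Subtype.exists,
        Subtype.forall, Finset.mem_union, exists_prop]
      grind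
    have h2 : ∀ v, {h : Hashes U m | (fun j : (M ∪ N : Finset _) => h j) ∈
          {f : (M ∪ N : Finset _) → Fin m |
          (∀ a ∈ insert v A, ∃ i : (M ∪ N : Finset _), i.1 ∈ N ∧ f i = a) ∧
          ∀ k : (M ∪ N : Finset _), k.1 ∈ M → ∃ i : (M ∪ N : Finset _), i.1 ∈ N ∧ f i = f k}} =
        {h | (∀ a ∈ insert v A, ∃ i ∈ N, h i = a) ∧ ∀ k ∈ M, ∃ i ∈ N, h i = h k} := by
      intro v
      ext h
      simp only [Set.mem_ofPred_eq, Finset.mem_insert, forall_eq_or_imp, Subtype.exists,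
        Subtype.forall, Finset.mem_union, exists_prop]
      grind
    rw [h1, hashLaw_real_eq_sum hlK fun v => {f : (M ∪ N : Finset _) → Fin m |
          (∀ a ∈ insert v A, ∃ i : (M ∪ N : Finset _), i.1 ∈ N ∧ f i = a) ∧
          ∀ k : (M ∪ N : Finset _), k.1 ∈ M → ∃ i : (M ∪ N : Finset _), i.1 ∈ N ∧ f i = f k}]
    simp only [h2]
    rw [Finset.card_insert_of_notMem hl]
    set p := hitProb m N.card with hp
    have hp0 : 0 ≤ p := hitProb_nonneg _ _
    have hp1 : p ≤ 1 := hitProb_le_one _ _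
    set X := p + ((A.card : ℝ) + (M.card + 1 : ℕ)) / m with hX
    have hX0 : 0 ≤ X := by positivity
    calc ∑ v, (hashLaw U m).real
          {h | (∀ a ∈ insert v A, ∃ i ∈ N, h i = a) ∧ ∀ k ∈ M, ∃ i ∈ N, h i = h k} / m
        -- A repeated position, of probability |A|/m, imposes nothing new; any other position
        -- contributes a further factor p.
        ≤ ∑ v, (if v ∈ A then p ^ A.card * X ^ M.card else p ^ A.card * X ^ M.card * p) / m := by
          refine Finset.sum_le_sum fun v _ => div_le_div_of_nonneg_right ?_ hm.le
          refine (ih hMN (insert v A)).trans ?_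
          split_ifs with hv
          · rw [Finset.insert_eq_of_mem hv]
            gcongr
            rw [hX]
            gcongr
            omega
          · rw [Finset.card_insert_of_notMem hv, pow_succ, mul_right_comm]
            gcongr
            rw [hX]
            gcongr p + ?_ / _
            push_cast
            linarith
      _ = p ^ A.card * X ^ M.card * ((A.card + (m - A.card) * p) / m) := by
          rw [← Finset.sum_div, Finset.sum_ite, Finset.sum_const, Finset.sum_const,
            Finset.filter_mem_eq_inter, Finset.univ_inter, Finset.filter_not,
            Finset.filter_mem_eq_inter, Finset.univ_inter, Finset.card_sdiff_of_subset
              (Finset.subset_univ A), Finset.card_univ, Fintype.card_fin, nsmul_eq_mul,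
            nsmul_eq_mul, Nat.cast_sub (by simpa using Finset.card_le_univ A)]
          ring
      _ ≤ p ^ A.card * X ^ M.card * X := by
          gcongr
          rw [div_le_iff₀ hm, hX, add_mul, div_mul_cancel₀ _ hm.ne']
          have h1 : 0 ≤ (A.card : ℝ) * p := by positivity
          have h2 : (0 : ℝ) ≤ (M.card + 1 : ℕ) := by positivity
          linarith
      _ = p ^ A.card * X ^ (M.card + 1) := by ring

/-- An element outside the range of the draws is a false positive with probability at most
`(hitProb + k / m) ^ k`. -/
theorem hashLaw_real_bloomAnswer_le (k : U → ℕ) {n : ℕ} (s : Fin n → U) {t : ℕ}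
    (ht : ∑ i, k (s i) ≤ t) {x : U} (hx : x ∉ Set.range s) :
    (hashLaw U m).real {h | bloomAnswer k h (Set.range s) x = true} ≤
      (hitProb m t + (k x : ℝ) / m) ^ k x := by
  classical
  let N : Finset (U × ℕ) := Finset.univ.biUnion fun i => {s i} ×ˢ Finset.range (k (s i))
  let M : Finset (U × ℕ) := {x} ×ˢ Finset.range (k x)
  have hN : ∀ y j, (y, j) ∈ N ↔ y ∈ Set.range s ∧ j < k y := by
    intro y j
    simp only [N, Finset.mem_biUnion, Finset.mem_univ, true_and, Finset.mem_product,
      Finset.mem_singleton, Finset.mem_range, Set.mem_range]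
    grind
  have hM : ∀ y j, (y, j) ∈ M ↔ y = x ∧ j < k x := by
    intro y j
    simp [M, and_comm, eq_comm]
  have hMN : Disjoint M N := by
    refine Finset.disjoint_left.2 ?_
    rintro ⟨y, j⟩ h1 h2
    exact hx (((hM y j).1 h1).1 ▸ ((hN y j).1 h2).1)
  -- Repeated draws are inserted once but counted with multiplicity in t.
  have hNt : N.card ≤ t := by
    refine (Finset.card_biUnion_le.trans_eq ?_).trans ht
    simp
  have hMc : M.card = k x := by simp [M]
  have hE : {h : Hashes U m | bloomAnswer k h (Set.range s) x = true} =
      {h | (∀ a ∈ (∅ : Finset (Fin m)), ∃ i ∈ N, h i = a) ∧ ∀ l ∈ M, ∃ i ∈ N, h i = h l} := by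
    ext h
    simp only [bloomAnswer, query, bitArray, Set.mem_ofPred_eq, decide_eq_true_eq, Prod.forall,
      Prod.exists, hM, hN, Finset.notMem_empty, false_imp_iff, implies_true, true_and]
    constructor
    · rintro H _ j ⟨rfl, hj⟩
      obtain ⟨y, hy, i, hi, he⟩ := H j hj
      exact ⟨y, i, ⟨hy, hi⟩, he⟩
    · intro H j hj
      obtain ⟨y, i, ⟨hy, hi⟩, he⟩ := H x j ⟨rfl, hj⟩
      exact ⟨y, hy, i, hi, he⟩
  rw [hE]
  refine (hashLaw_real_query_le hMN ∅).trans ?_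
  rw [hMc]
  simp only [Finset.card_empty, pow_zero, one_mul, Nat.cast_zero, zero_add]
  have h0 := hitProb_nonneg m N.card
  gcongr
  exact hitProb_mono m hNt

theorem hashLaw_bloomAnswer_of_mem (k : U → ℕ) {S : Set U} {x : U} (hx : x ∈ S) :
    hashLaw U m {h | bloomAnswer k h S x = true} = 1 := by
  have : {h : Hashes U m | bloomAnswer k h S x = true} = Set.univ := by
    ext h
    simp only [bloomAnswer, query, bitArray, Set.mem_ofPred_eq, Set.mem_univ, iff_true]
    refine decide_eq_true ?_
    simp only [decide_eq_true_eq]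
    exact fun i hi => ⟨x, hx, i, hi, rfl⟩
  rw [this, measure_univ]

end Hashing

-- Concentration of the load over the random draws.

section Draws

variable {U : Type*}

instance [MeasurableSpace U] (P : PMF U) (n : ℕ) : IsProbabilityMeasure (inputLaw P n) := by
  unfold inputLaw
  infer_instance

theorem measurableSet_draws [Countable U] [MeasurableSpace U] [DiscreteMeasurableSpace U] {n : ℕ}
    (E : Set (Fin n → U)) : MeasurableSet E :=
  E.to_countable.measurableSet

theorem integral_toMeasure_eq_tsum [Countable U] [MeasurableSpace U] [DiscreteMeasurableSpace U]
    (P : PMF U) {f : U → ℝ} (hf : Integrable f P.toMeasure) :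
    ∫ x, f x ∂P.toMeasure = ∑' x, prob P x * f x := by
  rw [integral_countable hf]
  refine tsum_congr fun x => ?_
  rw [Measure.real, PMF.toMeasure_apply_singleton _ _ (measurableSet_singleton x)]
  rfl

theorem integrable_of_bounded [Countable U] [MeasurableSpace U] [DiscreteMeasurableSpace U]
    (P : PMF U) {f : U → ℝ} {B : ℝ} (h0 : ∀ x, 0 ≤ f x) (hB : ∀ x, f x ≤ B) :
    Integrable f P.toMeasure :=
  Integrable.of_bound (Measurable.of_discrete).aestronglyMeasurable B
    (Filter.Eventually.of_forall fun x => by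
      rw [Real.norm_of_nonneg (h0 x)]
      exact hB x)

/-- A Chernoff bound for sums of independent draws of a bounded non-negative weight. -/
theorem inputLaw_real_sum_gt_le [Countable U] [MeasurableSpace U] [DiscreteMeasurableSpace U]
    (P : PMF U) (n : ℕ) {f : U → ℝ} {b t : ℝ} (h0 : ∀ x, 0 ≤ f x) (hb : ∀ x, f x ≤ b)
    (ht : 0 ≤ t) (htb : t * b ≤ 1) (a : ℝ) :
    (inputLaw P n).real {s | a < ∑ i, f (s i)} ≤
      Real.exp (n * (∑' x, prob P x * f x) * (t + t ^ 2 * b) - t * a) := by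
  have hint : Integrable f P.toMeasure := integrable_of_bounded P h0 hb
  have hintE : Integrable (fun x => Real.exp (t * f x)) P.toMeasure :=
    integrable_of_bounded P (B := Real.exp (t * b)) (fun x => (Real.exp_pos _).le)
      fun x => Real.exp_le_exp.2 (mul_le_mul_of_nonneg_left (hb x) ht)
  rw [← integral_toMeasure_eq_tsum P hint]
  set ν := ∫ x, f x ∂P.toMeasure
  have hone : ∫ x, Real.exp (t * f x) ∂P.toMeasure ≤ Real.exp (ν * (t + t ^ 2 * b)) := by
    calc ∫ x, Real.exp (t * f x) ∂P.toMeasure ≤ ∫ x, (1 + f x * (t + t ^ 2 * b)) ∂P.toMeasure := by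
          -- This is e^y ≤ 1 + y + y² for 0 ≤ y = t f ≤ 1, with (t f)² ≤ t² b f to keep the bound
          -- linear in f.
          refine integral_mono hintE ((integrable_const 1).add (hint.mul_const _)) fun x => ?_
          have h1 : 0 ≤ t * f x := mul_nonneg ht (h0 x)
          have h2 : t * f x ≤ 1 := (mul_le_mul_of_nonneg_left (hb x) ht).trans htb
          have h3 := (abs_le.1 (Real.abs_exp_sub_one_sub_id_le (by rwa [abs_of_nonneg h1]))).2
          have h4 : (t * f x) ^ 2 ≤ t ^ 2 * f x * b := by
            nlinarith [mul_le_mul_of_nonneg_left (hb x) (mul_nonneg (sq_nonneg t) (h0 x))]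
          show Real.exp (t * f x) ≤ 1 + f x * (t + t ^ 2 * b)
          nlinarith
      _ = 1 + ν * (t + t ^ 2 * b) := by
          rw [integral_add (integrable_const 1) (hint.mul_const _), integral_mul_const]
          simp [ν]
      _ ≤ _ := by
          rw [add_comm]
          exact Real.add_one_le_exp _
  have hprod : ∫ s, ∏ i, Real.exp (t * f (s i)) ∂(inputLaw P n) ≤
      Real.exp (n * ν * (t + t ^ 2 * b)) := by
    unfold inputLaw
    rw [integral_fintype_prod_eq_prod (fun (_ : Fin n) (x : U) => Real.exp (t * f x)),
      Finset.prod_const, Finset.card_univ, Fintype.card_fin]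
    refine (pow_le_pow_left₀ (integral_nonneg fun x => (Real.exp_pos _).le) hone n).trans_eq ?_
    rw [← Real.exp_nat_mul]
    ring_nf
  have hpi : Integrable (fun s : Fin n → U => ∏ i, Real.exp (t * f (s i))) (inputLaw P n) :=
    Integrable.fintype_prod (f := fun (_ : Fin n) (x : U) => Real.exp (t * f x)) fun _ => hintE
  have hM := mul_meas_ge_le_integral_of_nonneg
    (Filter.Eventually.of_forall fun s => Finset.prod_nonneg fun i _ => (Real.exp_pos _).le) hpi
    (Real.exp (t * a))
  rw [Real.exp_sub, le_div_iff₀ (Real.exp_pos _), mul_comm]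
  refine le_trans ?_ (hM.trans hprod)
  refine mul_le_mul_of_nonneg_left (measureReal_mono ?_) (Real.exp_pos _).le
  intro s hs
  rw [Set.mem_ofPred_eq, ← Real.exp_sum, ← Finset.mul_sum]
  exact Real.exp_le_exp.2 (mul_le_mul_of_nonneg_left (le_of_lt hs) ht)

end Draws

-- Occupation of the array under a typical load.

section Load

/-- Since 1 - 1/m ≥ e^{-1/(m-1)}, a position stays empty with probability at least e^{-y}. The bound
is the tangent line of e^{-y} at y = log 2, the load of a half-full array. -/
theorem hitProb_le_of_load {m t : ℕ} (hm : 2 ≤ m) {y : ℝ} (hy : t ≤ y * (m - 1)) :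
    2 * hitProb m t ≤ 1 - Real.log 2 + y := by
  have hm' : (2 : ℝ) ≤ m := by exact_mod_cast hm
  have hm1 : (0 : ℝ) < m - 1 := by linarith
  have h1 : Real.exp (-(1 / ((m : ℝ) - 1))) ≤ 1 - 1 / m := by
    rw [Real.exp_neg, show 1 - 1 / (m : ℝ) = (1 / ((m : ℝ) - 1) + 1)⁻¹ by
      have : (m : ℝ) ≠ 0 := by positivity
      field_simp
      ring]
    exact inv_anti₀ (by positivity) (Real.add_one_le_exp _)
  have h2 : Real.exp (-y) ≤ (1 - 1 / (m : ℝ)) ^ t := by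
    refine le_trans ?_ (pow_le_pow_left₀ (Real.exp_pos _).le h1 t)
    rw [← Real.exp_nat_mul, Real.exp_le_exp, mul_neg, mul_one_div, neg_le_neg_iff,
      div_le_iff₀ hm1]
    exact hy
  have h3 : Real.exp (-y) = Real.exp (Real.log 2 - y) / 2 := by
    rw [sub_eq_add_neg, Real.exp_add, Real.exp_log two_pos]
    ring
  have h4 := Real.add_one_le_exp (Real.log 2 - y)
  unfold hitProb
  linarith

/-- The occupation of an array of at least `L / log 2` bits after `t ≤ u + L / (100 b)` hash
values have been inserted. -/
theorem two_mul_hitProb_add_le {m t : ℕ} {b L u k : ℝ} (hb : 2 ≤ b) (hL : 1000 * b ^ 4 ≤ L)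
    (hm : L ≤ Real.log 2 * m) (hu0 : 0 ≤ u) (huL : u ≤ L) (ht : t ≤ u + L / (100 * b))
    (hk : k ≤ b) :
    2 * (hitProb m t + k / m) ≤ 1 - Real.log 2 * (1 - u / L) + 1 / (25 * b) := by
  have hb0 : 0 < b := by linarith
  have hL0 : 0 < L := lt_of_lt_of_le (by positivity) hL
  have l1 := Real.log_two_lt_d9
  have l0 : 0 < Real.log 2 := Real.log_pos one_lt_two
  have hbL : 4000 * b ^ 2 ≤ L := by
    nlinarith [mul_nonneg (sq_nonneg b) (show 0 ≤ b ^ 2 - 4 by nlinarith)]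
  have hmL : L ≤ m := by nlinarith [(Nat.cast_nonneg m : (0 : ℝ) ≤ m)]
  have hm2 : (2 : ℝ) ≤ m := by nlinarith
  have hm1 : (0 : ℝ) < m - 1 := by linarith
  have hm0 : (0 : ℝ) < m := by linarith
  -- Three errors, each at most 1/(100 b) after doubling k/m: the deviation of the load, the passage
  -- from m to m - 1, and the self-collisions. Together they fit in 1/(25 b).
  have e1 : 1 / ((m : ℝ) - 1) ≤ 1 / (100 * b) := by
    apply one_div_le_one_div_of_le (by positivity)
    nlinarith
  have e2 : k / m ≤ 1 / (200 * b) := by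
    rw [div_le_div_iff₀ hm0 (by positivity)]
    nlinarith
  have e3 : t / (m : ℝ) ≤ Real.log 2 * (u / L + 1 / (100 * b)) := by
    rw [div_le_iff₀ hm0]
    have : (u / L + 1 / (100 * b)) * L ≤ (u / L + 1 / (100 * b)) * (Real.log 2 * m) :=
      mul_le_mul_of_nonneg_left hm (by positivity)
    have h' : (u / L + 1 / (100 * b)) * L = u + L / (100 * b) := by
      field_simp
    linarith
  have huL' : u / L ≤ 1 := (div_le_one hL0).2 huL
  have e4 : 1 / (100 * b) ≤ 1 / 200 :=
    one_div_le_one_div_of_le (by norm_num) (by linarith)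
  have e5 : t / ((m : ℝ) - 1) = t / m + t / m * (1 / (m - 1)) := by
    field_simp
    ring
  have e6 : t / (m : ℝ) ≤ 1 := by nlinarith [div_nonneg hu0 hL0.le]
  have e7 : t / (m : ℝ) * (1 / (m - 1)) ≤ 1 * (1 / (100 * b)) :=
    mul_le_mul e6 e1 (by positivity) zero_le_one
  have e8 : Real.log 2 * (1 / (100 * b)) ≤ 1 * (1 / (100 * b)) :=
    mul_le_mul_of_nonneg_right (by linarith) (by positivity)
  have e9 := hitProb_le_of_load (m := m) (t := t) (by exact_mod_cast hm2)
    (y := t / ((m : ℝ) - 1)) (div_mul_cancel₀ _ hm1.ne').ge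
  have f1 : 1 / (25 * b) = 4 * (1 / (100 * b)) := by
    field_simp
    norm_num
  have f2 : 1 / (200 * b) = 1 / (100 * b) / 2 := by
    field_simp
    norm_num
  have f3 : 0 ≤ 1 / (100 * b) := by positivity
  rw [f1]
  linarith

theorem pow_le_exp_mul_sub_one {r : ℝ} (hr : 0 ≤ r) (k : ℕ) :
    r ^ k ≤ Real.exp (k * (r - 1)) := by
  rw [Real.exp_nat_mul]
  refine pow_le_pow_left₀ hr ?_ k
  have := Real.add_one_le_exp (r - 1)
  linarith

theorem exp_le_inv_one_sub {x : ℝ} (hx : x < 1) : Real.exp x ≤ (1 - x)⁻¹ := by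
  rw [← inv_inv (Real.exp x), ← Real.exp_neg]
  refine inv_anti₀ (by linarith) ?_
  have := Real.add_one_le_exp (-x)
  linarith

end Load

-- Summing the false positive probabilities against Q.

section FalsePositives

variable {U : Type*} {P Q : PMF U} {n : ℕ} {G : ℝ}

theorem hashCount_le_kReal (hn : 1 ≤ n) (hG : 0 < G) (hG1 : G < 1) (x : U) :
    (hashCount P Q n G x : ℝ) ≤ kReal P Q n G x :=
  Nat.floor_le (kReal_nonneg hn hG hG1 x)

theorem kReal_lt_hashCount_add_one (P Q : PMF U) (n : ℕ) (G : ℝ) (x : U) :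
    kReal P Q n G x < hashCount P Q n G x + 1 :=
  Nat.lt_floor_add_one _

theorem summable_prob_mul_prob (P Q : PMF U) : Summable fun x => prob P x * prob Q x :=
  summable_prob_mul P (prob_nonneg Q) (prob_le_one Q)

/-- The weighted false positive rate, if `x` is a false positive with probability at most
`2 ^ (-k_x) * r ^ k_x`. -/
theorem tsum_false_positive_le (hn : 1 ≤ n) (hG : 0 < G) (hG1 : G < 1) {S : Set U} {f : U → ℝ}
    {r R R' : ℝ} (hf0 : ∀ x, 0 ≤ f x)
    (hf : ∀ x ∉ S, f x ≤ (1 / 2) ^ hashCount P Q n G x * r ^ hashCount P Q n G x)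
    (hR0 : 0 ≤ R) (hR'0 : 0 ≤ R') (hR : ∀ x, r ^ hashCount P Q n G x ≤ R)
    (hR' : ∀ x, kReal P Q n G x = Real.logb 2 (1 / G) → r ^ hashCount P Q n G x ≤ R') :
    ∑' x : (Sᶜ : Set U), prob Q x * f x ≤
      R * G * (1 + ∑' x, prob P x * (kReal P Q n G x - hashCount P Q n G x))
        + 2 * R' * G + 2 * R * (n * ∑' x, prob P x * prob Q x) := by
  have hd0 : ∀ x, 0 ≤ kReal P Q n G x - hashCount P Q n G x := fun x =>
    sub_nonneg.2 (hashCount_le_kReal hn hG hG1 x)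
  have hd1 : ∀ x, kReal P Q n G x - hashCount P Q n G x ≤ 1 := fun x => by
    linarith [kReal_lt_hashCount_add_one P Q n G x]
  have hsd : Summable fun x => prob P x * (kReal P Q n G x - hashCount P Q n G x) :=
    summable_prob_mul P hd0 hd1
  let g : U → ℝ := fun x =>
    R * G * (prob P x + prob P x * (kReal P Q n G x - hashCount P Q n G x))
      + 2 * R' * G * prob Q x + 2 * R * (n * (prob P x * prob Q x))
  have hs1 : Summable fun x =>
      R * G * (prob P x + prob P x * (kReal P Q n G x - hashCount P Q n G x)) :=
    ((summable_prob P).add hsd).mul_left _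
  have hs2 : Summable fun x => 2 * R' * G * prob Q x := (summable_prob Q).mul_left _
  have hs3 : Summable fun x => 2 * R * (n * (prob P x * prob Q x)) :=
    ((summable_prob_mul_prob P Q).mul_left _).mul_left _
  have hg0 : ∀ x, 0 ≤ g x := fun x => by
    have := hd0 x
    have := prob_nonneg P x
    have := prob_nonneg Q x
    positivity
  have hgs : Summable g := (hs1.add hs2).add hs3
  have hle : ∀ x ∉ S, prob Q x * f x ≤ g x := by
    intro x hx
    have hp := prob_nonneg P x
    have hq := prob_nonneg Q x
    have h0 := hd0 x
    have h1 := hd1 x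
    -- Bernoulli's inequality for an exponent in [0, 1]: 2^δ ≤ 1 + δ. Unlike 2^δ ≤ 2, it retains the
    -- mean rounding error under P.
    have hw : ∀ w ≥ 0, w * 2 ^ (kReal P Q n G x - hashCount P Q n G x) ≤
        w * (1 + (kReal P Q n G x - hashCount P Q n G x)) := by
      intro w hw
      refine mul_le_mul_of_nonneg_left ?_ hw
      have := rpow_one_add_le_one_add_mul_self (s := 1) (by norm_num) h0 h1
      norm_num only [one_add_one_eq_two, mul_one] at this
      simpa [one_add_one_eq_two] using this
    have key : prob Q x * f x ≤ prob Q x * 2 ^ (-kReal P Q n G x) *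
        2 ^ (kReal P Q n G x - hashCount P Q n G x) * r ^ hashCount P Q n G x := by
      rw [mul_assoc (prob Q x), ← Real.rpow_add two_pos,
        show -kReal P Q n G x + (kReal P Q n G x - hashCount P Q n G x) =
          -(hashCount P Q n G x : ℝ) by ring, Real.rpow_neg two_pos.le, Real.rpow_natCast,
        mul_assoc, ← inv_pow, ← one_div]
      exact mul_le_mul_of_nonneg_left (hf x hx) hq
    have hz : 0 ≤ prob Q x * 2 ^ (-kReal P Q n G x) := by positivity
    have ht : (0 : ℝ) ≤ 2 ^ (kReal P Q n G x - hashCount P Q n G x) := by positivity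
    have bound : ∀ {w ρ : ℝ}, prob Q x * 2 ^ (-kReal P Q n G x) ≤ w → 0 ≤ ρ →
        r ^ hashCount P Q n G x ≤ ρ →
        prob Q x * f x ≤ w * (1 + (kReal P Q n G x - hashCount P Q n G x)) * ρ := by
      intro w ρ hw1 hρ hr
      have hw0 := hz.trans hw1
      calc prob Q x * f x ≤ _ := key
        _ ≤ prob Q x * 2 ^ (-kReal P Q n G x) *
            2 ^ (kReal P Q n G x - hashCount P Q n G x) * ρ :=
          mul_le_mul_of_nonneg_left hr (mul_nonneg hz ht)
        _ ≤ w * 2 ^ (kReal P Q n G x - hashCount P Q n G x) * ρ :=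
          mul_le_mul_of_nonneg_right (mul_le_mul_of_nonneg_right hw1 ht) hρ
        _ ≤ _ := mul_le_mul_of_nonneg_right (hw w hw0) hρ
    have g1 : 0 ≤ R * G * (prob P x + prob P x * (kReal P Q n G x - hashCount P Q n G x)) := by
      positivity
    have g2 : 0 ≤ 2 * R' * G * prob Q x := by positivity
    have g3 : 0 ≤ 2 * R * (n * (prob P x * prob Q x)) := by positivity
    rcases prob_mul_rpow_neg_kReal (P := P) (Q := Q) hn hG hG1 x with h | ⟨hk, h⟩ | h
    · have := bound h hR0 (hR x)
      simp only [g]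
      linarith
    -- The weight is now q_x, over which the mean of δ under P gives no control, so 1 + δ is bounded
    -- by 2.
    · have := bound h.le hR'0 (hR' x hk)
      have h2 : G * prob Q x * R' * (1 + (kReal P Q n G x - hashCount P Q n G x)) ≤
          G * prob Q x * R' * 2 := mul_le_mul_of_nonneg_left (by linarith) (by positivity)
      simp only [g]
      linarith
    · have := bound h hR0 (hR x)
      have h2 : n * (prob P x * prob Q x) * R * (1 + (kReal P Q n G x - hashCount P Q n G x)) ≤
          n * (prob P x * prob Q x) * R * 2 :=
        mul_le_mul_of_nonneg_left (by linarith) (by positivity)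
      simp only [g]
      linarith
  have hsub : Summable fun x : (Sᶜ : Set U) => prob Q x * f x :=
    Summable.of_nonneg_of_le (fun x => mul_nonneg (prob_nonneg Q x) (hf0 x))
      (fun x => hle x x.2) (hgs.subtype _)
  calc ∑' x : (Sᶜ : Set U), prob Q x * f x ≤ ∑' x : (Sᶜ : Set U), g x :=
        hsub.tsum_le_tsum (fun x => hle x x.2) (hgs.subtype _)
    _ ≤ ∑' x, g x := hgs.tsum_subtype_le _ _ hg0
    _ = _ := by
      rw [(hs1.add hs2).tsum_add hs3, hs1.tsum_add hs2, tsum_mul_left, tsum_mul_left,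
        tsum_mul_left, tsum_mul_left, (summable_prob P).tsum_add hsd, tsum_prob, tsum_prob,
        mul_one]

end FalsePositives

-- The length of the array.

section Space

variable {U : Type*} {P Q : PMF U} {n : ℕ} {F : ℝ}

theorem logb_two_exp_one : Real.logb 2 (Real.exp 1) = 1 / Real.log 2 := by
  rw [Real.logb, Real.log_exp]

theorem DB_le_bits (P Q : PMF U) (n : ℕ) (F : ℝ) : DB P Q n F ≤ bits P Q n F :=
  (Nat.le_ceil _).trans (by exact_mod_cast le_max_right _ _)

theorem DB_nonneg (hn : 1 ≤ n) (hF : 0 < F) (hF1 : F < 1) : 0 ≤ DB P Q n F := by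
  have h := LB_nonneg (P := P) (Q := Q) (n := n) (G := F / 6) hn (by positivity) (by linarith)
  rw [DB, logb_two_exp_one]
  have := Real.log_pos one_lt_two
  positivity

theorem bits_le (hn : 1 ≤ n) (hF : 0 < F) (hF1 : F < 1) :
    (bits P Q n F : ℝ) ≤ DB P Q n F + 1 := by
  have h := DB_nonneg (P := P) (Q := Q) hn hF hF1
  rw [bits, Nat.cast_max, Nat.cast_one]
  exact max_le (by linarith) (Nat.ceil_lt_add_one h).le

theorem LB_le_log_two_mul_bits (P Q : PMF U) (n : ℕ) (F : ℝ) :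
    LB P Q n (F / 6) ≤ Real.log 2 * bits P Q n F := by
  have h := DB_le_bits P Q n F
  have h0 := Real.log_pos one_lt_two
  rwa [DB, logb_two_exp_one, one_div_mul_eq_div, div_le_iff₀' h0] at h

theorem abs_DB_sub_le (hn : 1 ≤ n) (hF : 0 < F) (hF1 : F < 1) :
    |Real.logb 2 (Real.exp 1) * LB P Q n (F / 6) - Real.logb 2 (Real.exp 1) * LB P Q n F| ≤
      1000 * n := by
  obtain ⟨h1, h2⟩ := LB_sub_mem (P := P) (Q := Q) (n := n) (G := F / 6) (H := F) hn
    (by positivity) (by linarith) hF1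
  have h6 : F / (F / 6) = 6 := by
    field_simp
  have h7 : Real.logb 2 6 ≤ 3 := by
    rw [Real.logb_le_iff_le_rpow one_lt_two (by norm_num)]
    norm_num
  have l0 := Real.log_two_gt_d9
  have h8 : 1 / Real.log 2 ≤ 2 := by
    rw [div_le_iff₀ (by linarith)]
    linarith
  rw [h6] at h2
  have hn0 : (0 : ℝ) ≤ n := n.cast_nonneg
  rw [← mul_sub, logb_two_exp_one, abs_of_nonneg (mul_nonneg (by positivity) (by linarith))]
  have h9 : LB P Q n (F / 6) - LB P Q n F ≤ n * 3 := by
    nlinarith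
  calc 1 / Real.log 2 * (LB P Q n (F / 6) - LB P Q n F) ≤ 2 * (n * 3) :=
        mul_le_mul h8 h9 (by linarith) (by norm_num)
    _ ≤ 1000 * n := by linarith

end Space

-- Typical input sets and the false positive rate.

section Main

variable {U : Type*} {P Q : PMF U} {n : ℕ} {F G : ℝ}

/-- The expected number of hash values computed for the `n` draws. -/
def meanLoad (P Q : PMF U) (n : ℕ) (G : ℝ) : ℝ :=
  n * ∑' x, prob P x * hashCount P Q n G x

/-- The sets of draws whose load exceeds its mean by at most `LB / (100 log₂ (6 / F))`. -/
def typicalSets (P Q : PMF U) (n : ℕ) (F G : ℝ) : Set (Set U) :=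
  {S | ∃ s : Fin n → U, Set.range s = S ∧
    ∑ i, (hashCount P Q n G (s i) : ℝ) ≤
      meanLoad P Q n G + LB P Q n (F / 6) / (100 * Real.logb 2 (6 / F))}

theorem summable_prob_mul_hashCount (hn : 1 ≤ n) (hG : 0 < G) (hG1 : G < 1) :
    Summable fun x => prob P x * hashCount P Q n G x :=
  summable_prob_mul P (fun _ => Nat.cast_nonneg _) fun x =>
    (hashCount_le_kReal hn hG hG1 x).trans (kReal_le hn hG hG1 x)

theorem meanLoad_nonneg (P Q : PMF U) (n : ℕ) (G : ℝ) : 0 ≤ meanLoad P Q n G :=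
  mul_nonneg n.cast_nonneg
    (tsum_nonneg fun x => mul_nonneg (prob_nonneg P x) (Nat.cast_nonneg _))

/-- Rounding down the hash counts lowers the mean load by the mean rounding error. -/
theorem meanLoad_eq (hn : 1 ≤ n) (hG : 0 < G) (hG1 : G < 1) :
    meanLoad P Q n G = LB P Q n G
      - n * ∑' x, prob P x * (kReal P Q n G x - hashCount P Q n G x) := by
  have hs : Summable fun x => prob P x * kReal P Q n G x :=
    summable_prob_mul P (kReal_nonneg hn hG hG1) (kReal_le hn hG hG1)
  simp only [mul_sub]
  rw [LB_eq_tsum hn hG hG1, hs.tsum_sub (summable_prob_mul_hashCount hn hG hG1), meanLoad]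
  ring

theorem tsum_rounding_mem (hn : 1 ≤ n) (hG : 0 < G) (hG1 : G < 1) :
    0 ≤ ∑' x, prob P x * (kReal P Q n G x - hashCount P Q n G x) ∧
      ∑' x, prob P x * (kReal P Q n G x - hashCount P Q n G x) ≤ 1 := by
  have hd0 : ∀ x, 0 ≤ kReal P Q n G x - hashCount P Q n G x := fun x =>
    sub_nonneg.2 (hashCount_le_kReal hn hG hG1 x)
  have hd1 : ∀ x, kReal P Q n G x - hashCount P Q n G x ≤ 1 := fun x => by
    linarith [kReal_lt_hashCount_add_one P Q n G x]
  refine ⟨tsum_nonneg fun x => mul_nonneg (prob_nonneg P x) (hd0 x), ?_⟩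
  rw [← tsum_prob P]
  exact (summable_prob_mul P hd0 hd1).tsum_le_tsum
    (fun x => mul_le_of_le_one_right (prob_nonneg P x) (hd1 x)) (summable_prob P)

/-- This turns a saving of n/2 hash values into a relative saving of 1/(2b) in the load. -/
theorem LB_le_mul_logb (hn : 1 ≤ n) (hG : 0 < G) (hG1 : G < 1) :
    LB P Q n G ≤ n * Real.logb 2 (1 / G) := by
  rw [LB_eq_tsum hn hG hG1]
  refine mul_le_mul_of_nonneg_left ?_ n.cast_nonneg
  calc ∑' x, prob P x * kReal P Q n G x ≤ ∑' x, prob P x * Real.logb 2 (1 / G) :=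
        (summable_prob_mul P (kReal_nonneg hn hG hG1) (kReal_le hn hG hG1)).tsum_le_tsum
          (fun x => mul_le_mul_of_nonneg_left (kReal_le hn hG hG1 x) (prob_nonneg P x))
          ((summable_prob P).mul_right _)
    _ = _ := by rw [tsum_mul_right, tsum_prob, one_mul]

theorem two_le_logb_six_div (hF : 0 < F) (hF1 : F < 1) : 2 ≤ Real.logb 2 (6 / F) := by
  rw [Real.le_logb_iff_rpow_le one_lt_two (by positivity), le_div_iff₀ hF]
  norm_num
  linarith

theorem param_mem (hF : 0 < F) (hF1 : F < 1) (hG : G = F ∨ G = F / 6) :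
    0 < G ∧ G < 1 ∧ F / 6 ≤ G ∧ G ≤ F := by
  rcases hG with rfl | rfl
  · exact ⟨hF, hF1, by linarith, le_rfl⟩
  · exact ⟨by positivity, by linarith, le_rfl, by linarith⟩

theorem logb_one_div_le (hF : 0 < F) (hG : F / 6 ≤ G) :
    Real.logb 2 (1 / G) ≤ Real.logb 2 (6 / F) := by
  have hG0 : 0 < G := lt_of_lt_of_le (by positivity) hG
  refine Real.logb_le_logb_of_le one_lt_two (by positivity) ?_
  rw [div_le_div_iff₀ hG0 hF]
  linarith

theorem hashCount_le_logb (hn : 1 ≤ n) (hF : 0 < F) (hG : F / 6 ≤ G) (hG1 : G < 1) (x : U) :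
    (hashCount P Q n G x : ℝ) ≤ Real.logb 2 (6 / F) :=
  ((hashCount_le_kReal hn (lt_of_lt_of_le (by positivity) hG) hG1 x).trans
    (kReal_le hn (lt_of_lt_of_le (by positivity) hG) hG1 x)).trans (logb_one_div_le hF hG)

theorem meanLoad_le_LB (hn : 1 ≤ n) (hF : 0 < F) (hG : F / 6 ≤ G) (hG1 : G < 1) :
    meanLoad P Q n G ≤ LB P Q n (F / 6) := by
  have hG0 : 0 < G := lt_of_lt_of_le (by positivity) hG
  have h1 := (LB_sub_mem (P := P) (Q := Q) hn (show 0 < F / 6 by positivity) hG hG1).1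
  have h2 := mul_nonneg (Nat.cast_nonneg n : (0 : ℝ) ≤ n)
    (tsum_rounding_mem (P := P) (Q := Q) hn hG0 hG1).1
  rw [meanLoad_eq hn hG0 hG1]
  linarith

theorem inputLaw_real_typicalSets_ge [Countable U] [MeasurableSpace U]
    [DiscreteMeasurableSpace U] (hn : 1 ≤ n) (hF : 0 < F) (hF1 : F < 1) (hG : F / 6 ≤ G)
    (hG1 : G < 1) :
    1 - Real.exp (-(1 / 40000 * LB P Q n (F / 6) / Real.logb 2 (6 / F) ^ 3)) ≤
      (inputLaw P n).real {s | Set.range s ∈ typicalSets P Q n F G} := by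
  have hb := two_le_logb_six_div hF hF1
  have hμL := meanLoad_le_LB (P := P) (Q := Q) hn hF hG hG1
  set b := Real.logb 2 (6 / F) with hbdef
  set L := LB P Q n (F / 6) with hL
  have hb0 : 0 < b := by linarith
  let E : Set (Fin n → U) :=
    {s | meanLoad P Q n G + L / (100 * b) < ∑ i, (hashCount P Q n G (s i) : ℝ)}
  have hsub : Eᶜ ⊆ {s | Set.range s ∈ typicalSets P Q n F G} := fun s hs =>
    ⟨s, rfl, not_lt.1 hs⟩
  refine le_trans ?_ (measureReal_mono hsub)
  rw [probReal_compl_eq_one_sub (measurableSet_draws E)]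
  refine sub_le_sub_left ?_ 1
  -- The value t = 1/(200 b²) minimizes L t² b - t L/(100 b), with minimum -L/(40000 b³).
  have ht : 1 / (200 * b ^ 2) * b ≤ 1 := by
    rw [one_div_mul_eq_div, div_le_one (by positivity)]
    nlinarith
  refine (inputLaw_real_sum_gt_le P n (f := fun x => (hashCount P Q n G x : ℝ))
    (t := 1 / (200 * b ^ 2)) (fun x => Nat.cast_nonneg _)
    (hashCount_le_logb hn hF hG hG1) (by positivity) ht _).trans ?_
  rw [Real.exp_le_exp]
  change meanLoad P Q n G * _ - _ ≤ _
  have h1 := mul_le_mul_of_nonneg_right hμL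
    (show 0 ≤ (1 / (200 * b ^ 2)) ^ 2 * b by positivity)
  have h2 : L * ((1 / (200 * b ^ 2)) ^ 2 * b) - 1 / (200 * b ^ 2) * (L / (100 * b)) =
      -(1 / 40000 * L / b ^ 3) := by
    field_simp
    ring
  linarith

theorem isQFilter_of_tsum_le {S : Set U} {ε : ℝ}
    (h : ∑' x : (Sᶜ : Set U), prob Q x * (hashLaw U (bits P Q n F)).real
      {ω | bloomAnswer (hashCount P Q n G) ω S x = true} ≤ ε) :
    DaisyIsQFilter P Q n F G S ε :=
  ⟨fun _ hx => hashLaw_bloomAnswer_of_mem _ hx, h⟩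

theorem daisyIsQFilter_of_one_le {S : Set U} {ε : ℝ} (hε : 1 ≤ ε) :
    DaisyIsQFilter P Q n F G S ε := by
  refine isQFilter_of_tsum_le (le_trans ?_ hε)
  have hle : ∀ x, prob Q x * (hashLaw U (bits P Q n F)).real
      {ω | bloomAnswer (hashCount P Q n G) ω S x = true} ≤ prob Q x := fun x =>
    mul_le_of_le_one_right (prob_nonneg Q x) measureReal_le_one
  have h0 : ∀ x, 0 ≤ prob Q x * (hashLaw U (bits P Q n F)).real
      {ω | bloomAnswer (hashCount P Q n G) ω S x = true} := fun x =>
    mul_nonneg (prob_nonneg Q x) measureReal_nonneg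
  have hs := Summable.of_nonneg_of_le h0 hle (summable_prob Q)
  calc _ ≤ ∑' x, prob Q x * (hashLaw U (bits P Q n F)).real
        {ω | bloomAnswer (hashCount P Q n G) ω S x = true} := hs.tsum_subtype_le _ _ h0
    _ ≤ ∑' x, prob Q x := hs.tsum_le_tsum hle (summable_prob Q)
    _ = 1 := tsum_prob Q

/-- The logarithmic excess of the occupation of the array over one half. -/
def excess (P Q : PMF U) (n : ℕ) (F G : ℝ) : ℝ :=
  1 / (25 * Real.logb 2 (6 / F)) - Real.log 2 * (1 - meanLoad P Q n G / LB P Q n (F / 6))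

theorem daisyIsQFilter_of_exp_le (hn : 1 ≤ n) (hF : 0 < F) (hF1 : F < 1) (hG : F / 6 ≤ G)
    (hG1 : G < 1) (hL : 1000 * Real.logb 2 (6 / F) ^ 4 ≤ LB P Q n (F / 6)) {S : Set U}
    (hS : S ∈ typicalSets P Q n F G) {R R' : ℝ} (hR0 : 0 ≤ R) (hR'0 : 0 ≤ R')
    (hR : ∀ x, Real.exp (hashCount P Q n G x * excess P Q n F G) ≤ R)
    (hR' : ∀ x, kReal P Q n G x = Real.logb 2 (1 / G) →
      Real.exp (hashCount P Q n G x * excess P Q n F G) ≤ R') :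
    DaisyIsQFilter P Q n F G S
      (R * G * (1 + ∑' x, prob P x * (kReal P Q n G x - hashCount P Q n G x))
        + 2 * R' * G + 2 * R * (n * ∑' x, prob P x * prob Q x)) := by
  have hG0 : 0 < G := lt_of_lt_of_le (by positivity) hG
  obtain ⟨s, rfl, hs⟩ := hS
  have hb := two_le_logb_six_div hF hF1
  have hload : ∀ k ≤ Real.logb 2 (6 / F),
      2 * (hitProb (bits P Q n F) (∑ i, hashCount P Q n G (s i)) + k / bits P Q n F) ≤
        1 + excess P Q n F G := by
    intro k hk
    have := two_mul_hitProb_add_le hb hL (LB_le_log_two_mul_bits P Q n F)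
      (meanLoad_nonneg P Q n G) (meanLoad_le_LB hn hF hG hG1)
      (t := ∑ i, hashCount P Q n G (s i)) (by push_cast; exact hs) hk
    unfold excess
    linarith
  have hr0 : 0 ≤ 1 + excess P Q n F G := by
    have h1 := hload 0 (by linarith)
    have h2 := hitProb_nonneg (bits P Q n F) (∑ i, hashCount P Q n G (s i))
    rw [zero_div, add_zero] at h1
    linarith
  have hpow : ∀ x, (1 + excess P Q n F G) ^ hashCount P Q n G x ≤
      Real.exp (hashCount P Q n G x * excess P Q n F G) := fun x => by
    simpa using pow_le_exp_mul_sub_one hr0 (hashCount P Q n G x)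
  refine isQFilter_of_tsum_le (tsum_false_positive_le hn hG0 hG1
    (f := fun x => (hashLaw U (bits P Q n F)).real
      {ω | bloomAnswer (hashCount P Q n G) ω (Set.range s) x = true})
    (r := 1 + excess P Q n F G) (fun x => measureReal_nonneg) (fun x hx => ?_) hR0 hR'0
    (fun x => (hpow x).trans (hR x)) (fun x hx => (hpow x).trans (hR' x hx)))
  refine (hashLaw_real_bloomAnswer_le (hashCount P Q n G) s le_rfl hx).trans ?_
  rw [← mul_pow]
  have h2 := hitProb_nonneg (bits P Q n F) (∑ i, hashCount P Q n G (s i))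
  refine pow_le_pow_left₀ (by positivity) ?_ _
  have := hload _ (hashCount_le_logb (P := P) (Q := Q) hn hF hG hG1 x)
  linarith

theorem exp_hashCount_mul_excess_le (hn : 1 ≤ n) (hF : 0 < F) (hF1 : F < 1) (hG : F / 6 ≤ G)
    (hG1 : G < 1) (x : U) :
    Real.exp (hashCount P Q n G x * excess P Q n F G) ≤ 21 / 20 := by
  have hb := two_le_logb_six_div hF hF1
  have hk := hashCount_le_logb (P := P) (Q := Q) hn hF hG hG1 x
  have hL0 : 0 ≤ LB P Q n (F / 6) := LB_nonneg hn (by positivity) (by linarith)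
  have hq : meanLoad P Q n G / LB P Q n (F / 6) ≤ 1 :=
    div_le_one_of_le₀ (meanLoad_le_LB hn hF hG hG1) hL0
  have he : excess P Q n F G ≤ 1 / (25 * Real.logb 2 (6 / F)) :=
    sub_le_self _ (mul_nonneg (Real.log_nonneg one_le_two) (by linarith))
  have h1 : hashCount P Q n G x * excess P Q n F G ≤ 1 / 25 := by
    calc hashCount P Q n G x * excess P Q n F G
        ≤ Real.logb 2 (6 / F) * (1 / (25 * Real.logb 2 (6 / F))) :=
          (mul_le_mul_of_nonneg_left he (Nat.cast_nonneg _)).trans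
            (mul_le_mul_of_nonneg_right hk (by positivity))
      _ = 1 / 25 := by
          field_simp
  calc _ ≤ Real.exp (1 / 25) := Real.exp_le_exp.2 h1
    _ ≤ (1 - 1 / 25)⁻¹ := exp_le_inv_one_sub (by norm_num)
    _ ≤ 21 / 20 := by norm_num

theorem daisyIsQFilter_const_mul (hn : 1 ≤ n) (hF : 0 < F) (hF1 : F < 1)
    (hG : G = F ∨ G = F / 6) (hPQ : n * ∑' x, prob P x * prob Q x ≤ F)
    (hL : 1000 * Real.logb 2 (6 / F) ^ 4 ≤ LB P Q n (F / 6)) {S : Set U}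
    (hS : S ∈ typicalSets P Q n F G) : DaisyIsQFilter P Q n F G S (7 * F) := by
  obtain ⟨hG0, hG1, hGl, hGu⟩ := param_mem hF hF1 hG
  have hR := exp_hashCount_mul_excess_le (P := P) (Q := Q) hn hF hF1 hGl hG1
  have h := daisyIsQFilter_of_exp_le hn hF hF1 hGl hG1 hL hS (R := 21 / 20) (R' := 21 / 20)
    (by norm_num) (by norm_num) hR fun x _ => hR x
  refine ⟨h.1, h.2.trans ?_⟩
  obtain ⟨a0, a1⟩ := tsum_rounding_mem (P := P) (Q := Q) hn hG0 hG1
  -- With G ≤ F and mean rounding error at most 1, the bound is at most (21/20)(2 + 2 + 2) F ≤ 7 F.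
  nlinarith

/-- If the rounding errors are small on average they hardly affect the contribution of the
elements with `q_x ≤ p_x`; if they are large, the array is noticeably emptier than half full,
which makes up for the rounding error of the elements with `k_x = log₂ (1 / G)`. -/
theorem daisyIsQFilter_sharp (hn : 1 ≤ n) (hF : 0 < F) (hF1 : F < 1)
    (hPQ : n * ∑' x, prob P x * prob Q x ≤ F / 6)
    (hL : 1000 * Real.logb 2 (6 / F) ^ 4 ≤ LB P Q n (F / 6)) {S : Set U}
    (hS : S ∈ typicalSets P Q n F (F / 6)) : DaisyIsQFilter P Q n F (F / 6) S F := by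
  obtain ⟨hG0, hG1, hGl, hGu⟩ := param_mem hF hF1 (Or.inr rfl : F / 6 = F ∨ F / 6 = F / 6)
  obtain ⟨a0, a1⟩ := tsum_rounding_mem (P := P) (Q := Q) hn hG0 hG1
  -- With mean rounding error at most 1/2, the bound is (21/20)(3/2 + 2 + 2)/6 < 1 times F.
  rcases le_or_gt (∑' x, prob P x * (kReal P Q n (F / 6) x - hashCount P Q n (F / 6) x)) (1 / 2)
    with ha | ha
  · have hR := exp_hashCount_mul_excess_le (P := P) (Q := Q) hn hF hF1 hGl hG1
    have h := daisyIsQFilter_of_exp_le hn hF hF1 hGl hG1 hL hS (R := 21 / 20) (R' := 21 / 20)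
      (by norm_num) (by norm_num) hR fun x _ => hR x
    refine ⟨h.1, h.2.trans ?_⟩
    nlinarith
  have hb := two_le_logb_six_div hF hF1
  have hlog : Real.logb 2 (1 / (F / 6)) = Real.logb 2 (6 / F) := by rw [one_div_div]
  have hLn := LB_le_mul_logb (P := P) (Q := Q) hn hG0 hG1
  rw [hlog] at hLn
  have hL0 : 0 < LB P Q n (F / 6) := lt_of_lt_of_le (by positivity) hL
  -- The mean load falls short of L by more than n/2, a fraction at least 1/(2b). As (log 2)/2 ≥
  -- 34/100, this outweighs the error 4/(100 b).
  have he : excess P Q n F (F / 6) ≤ -(3 / 10 / Real.logb 2 (6 / F)) := by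
    have h1 : 1 / 2 / Real.logb 2 (6 / F) ≤
        1 - meanLoad P Q n (F / 6) / LB P Q n (F / 6) := by
      rw [meanLoad_eq hn hG0 hG1, sub_div, div_self hL0.ne', sub_sub_cancel,
        div_le_div_iff₀ (by linarith) hL0]
      have hn0 : (0 : ℝ) ≤ n := n.cast_nonneg
      have h2 : n * (1 / 2) * Real.logb 2 (6 / F) ≤
          n * (∑' x, prob P x * (kReal P Q n (F / 6) x - hashCount P Q n (F / 6) x))
            * Real.logb 2 (6 / F) := by
        gcongr
      linarith
    have h3 : 34 / 100 / Real.logb 2 (6 / F) ≤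
        Real.log 2 * (1 / 2 / Real.logb 2 (6 / F)) := by
      rw [mul_div_assoc']
      have := Real.log_two_gt_d9
      gcongr
      linarith
    have h4 : 1 / (25 * Real.logb 2 (6 / F)) = 4 / 100 / Real.logb 2 (6 / F) := by
      field_simp
      norm_num
    have h5 : 3 / 10 / Real.logb 2 (6 / F) =
        34 / 100 / Real.logb 2 (6 / F) - 4 / 100 / Real.logb 2 (6 / F) := by
      rw [← sub_div]
      norm_num
    have h6 := mul_le_mul_of_nonneg_left h1 (Real.log_nonneg one_le_two)
    unfold excess
    linarith
  have he' : ∀ x, hashCount P Q n (F / 6) x * excess P Q n F (F / 6) ≤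
      -(hashCount P Q n (F / 6) x * (3 / 10) / Real.logb 2 (6 / F)) := fun x => by
    have := mul_le_mul_of_nonneg_left he (Nat.cast_nonneg (α := ℝ) (hashCount P Q n (F / 6) x))
    refine this.trans_eq ?_
    ring
  have h := daisyIsQFilter_of_exp_le hn hF hF1 hGl hG1 hL hS (R := 1) (R' := 20 / 23)
    (by norm_num) (by norm_num)
    (fun x => Real.exp_le_one_iff.2 ((he' x).trans (neg_nonpos.2 (by positivity))))
    (fun x hx => by
      have h1 := kReal_lt_hashCount_add_one P Q n (F / 6) x
      rw [hx, hlog] at h1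
      -- Here k_x = b, and its floor exceeds b - 1 ≥ b/2 because b ≥ 2.
      have h2 : 3 / 20 ≤ hashCount P Q n (F / 6) x * (3 / 10) / Real.logb 2 (6 / F) := by
        rw [le_div_iff₀ (by linarith)]
        linarith
      calc _ ≤ Real.exp (-(3 / 20)) :=
            Real.exp_le_exp.2 ((he' x).trans (neg_le_neg h2))
        _ ≤ (1 - -(3 / 20))⁻¹ := exp_le_inv_one_sub (by norm_num)
        _ ≤ 20 / 23 := by norm_num)
  refine ⟨h.1, h.2.trans ?_⟩
  nlinarith

/-- For L below the threshold 1000 b⁴ the exponential is at least 1 - 1/40, so the claimed rate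
exceeds 1 and holds trivially. -/
theorem one_le_const_mul_add_exp {b L : ℝ} (hF : 0 < F) (hb : 0 < b) (hL : L ≤ 1000 * b ^ 4) :
    1 ≤ 1000 * (F + Real.exp (-(1 / 40000 * L / b ^ 4))) := by
  have h1 : 1 / 40000 * L / b ^ 4 ≤ 1 / 40 := by
    rw [div_le_iff₀ (by positivity)]
    linarith
  have h2 := Real.add_one_le_exp (-(1 / 40000 * L / b ^ 4))
  linarith

end Main

end Daisy

end

theorem theorem2 :
    ∃ c C : ℝ, 0 < c ∧ 0 < C ∧
      ∀ (U : Type*) [Countable U] [MeasurableSpace U] [DiscreteMeasurableSpace U]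
        (P Q : PMF U) (n : ℕ) (F : ℝ), 1 ≤ n → 0 < F → F < 1 →
        -- space
        (Daisy.DB P Q n F ≤ Daisy.bits P Q n F ∧
          (Daisy.bits P Q n F : ℝ) ≤ Daisy.DB P Q n F + 1 ∧
          Daisy.DB P Q n F = Real.logb 2 (Real.exp 1) * Daisy.LB P Q n (F / 6) ∧
          |Real.logb 2 (Real.exp 1) * Daisy.LB P Q n (F / 6)
            - Real.logb 2 (Real.exp 1) * Daisy.LB P Q n F| ≤ C * n) ∧
        -- correctness, for hash counts computed from `F` and for those computed from `F / 6`
        ((n : ℝ) * ∑' x, Daisy.prob P x * Daisy.prob Q x ≤ F →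
          ∀ G : ℝ, G = F ∨ G = F / 6 →
            ∃ T : Set (Set U),
              1 - Real.exp (-(c * Daisy.LB P Q n (F / 6) / Real.logb 2 (6 / F) ^ 3))
                ≤ (Daisy.inputLaw P n).real {s | Set.range s ∈ T} ∧
              ∀ S ∈ T,
                Daisy.DaisyIsQFilter P Q n F G S
                  (C * (F + Real.exp
                    (-(c * Daisy.LB P Q n (F / 6) / Real.logb 2 (6 / F) ^ 4)))) ∧
                (C * Real.logb 2 (6 / F) ^ 4 ≤ Daisy.LB P Q n (F / 6) →
                  Daisy.DaisyIsQFilter P Q n F G S (C * F) ∧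
                  (G = F / 6 → (n : ℝ) * ∑' x, Daisy.prob P x * Daisy.prob Q x ≤ F / 6 →
                    Daisy.DaisyIsQFilter P Q n F G S F))) := by
  -- The Chernoff exponent dictates c; C is the threshold constant needed for the occupation bound
  -- and amply covers the other uses.
  refine ⟨1 / 40000, 1000, by norm_num, by norm_num, ?_⟩
  intro U _ _ _ P Q n F hn hF hF1
  refine ⟨⟨Daisy.DB_le_bits P Q n F, Daisy.bits_le hn hF hF1, rfl,
    Daisy.abs_DB_sub_le hn hF hF1⟩, fun hPQ G hG => ?_⟩
  obtain ⟨hG0, hG1, hGl, hGu⟩ := Daisy.param_mem hF hF1 hG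
  have hb := Daisy.two_le_logb_six_div hF hF1
  refine ⟨Daisy.typicalSets P Q n F G,
    Daisy.inputLaw_real_typicalSets_ge hn hF hF1 hGl hG1, fun S hS => ⟨?_, fun hL => ⟨?_, ?_⟩⟩⟩
  · rcases le_total (Daisy.LB P Q n (F / 6)) (1000 * Real.logb 2 (6 / F) ^ 4) with hL | hL
    · exact Daisy.daisyIsQFilter_of_one_le
        (Daisy.one_le_const_mul_add_exp hF (by linarith) hL)
    · have h := Daisy.daisyIsQFilter_const_mul hn hF hF1 hG hPQ hL hS
      refine ⟨h.1, h.2.trans ?_⟩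
      have := Real.exp_pos
        (-(1 / 40000 * Daisy.LB P Q n (F / 6) / Real.logb 2 (6 / F) ^ 4))
      linarith
  · have h := Daisy.daisyIsQFilter_const_mul hn hF hF1 hG hPQ hL hS
    exact ⟨h.1, h.2.trans (by linarith)⟩
  · rintro rfl hPQ'
    exact Daisy.daisyIsQFilter_sharp hn hF hF1 hPQ' hL hS
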